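/- Let $R$ be a commutative noetherian local ring with maximal ideal $\mathfrak m$ and residue field $k=R/\mathfrak m$, and let $t=\operatorname{depth} R$ be the supremum of the lengths of $R$-regular sequences contained in $\mathfrak m$. Assume $t\ge 3$. Let $$\cdots\xrightarrow{d_3}F_2\xrightarrow{d_2}F_1\xrightarrow{d_1}F_0\to k\to 0$$ be a minimal free resolution of $k$ over $R$ (an exact sequence of $R$-modules in which every $F_n$ is a finitely generated free $R$-module and $d_{n+1}(F_{n+1})\subseteq\mathfrak m F_n$ for all $n\ge 0$). For $n\ge 0$ let $\Omega^n k=\operatorname{Coker}(d_{n+1}\colon F_{n+1}\to F_n)$ be the $n$-th syzygy of $k$, and write $(-)^*=\operatorname{Hom}_R(-,R)$. If $(\Omega^i k)^*\cong\Omega^i k$ as $R$-modules for some integer $i$ with $2\le i<t$, then $R$ is a regular local ring and $t=2i-1$. -/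

import Mathlib

universe u

/-- The depth of a local ring: the supremum of the lengths of the regular sequences on `R`
consisting of elements of the maximal ideal. -/
noncomputable def localDepth (R : Type u) [CommRing R] [IsLocalRing R] : ℕ∞ :=
  ⨆ rs : {rs : List R // RingTheory.Sequence.IsRegular R rs ∧
    ∀ r ∈ rs, r ∈ IsLocalRing.maximalIdeal R}, (rs.1.length : ℕ∞)

/-- A minimal free resolution `⋯ → F 2 → F 1 → F 0 → M → 0` of a module `M` over a local ring `R`:
an exact sequence with every `F n` finitely generated free, in which the image of each differential
lies in `𝔪 • F n`. Here `d n` is the differential `F (n + 1) → F n`, usually written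
`d_{n+1}`. -/
structure MinimalFreeResolution (R : Type u) [CommRing R] [IsLocalRing R]
    (M : Type u) [AddCommGroup M] [Module R M] where
  /-- the free modules of the resolution -/
  F : ℕ → Type u
  [addCommGroup : ∀ n, AddCommGroup (F n)]
  [module : ∀ n, Module R (F n)]
  [free : ∀ n, Module.Free R (F n)]
  [finite : ∀ n, Module.Finite R (F n)]
  /-- the differentials -/
  d : ∀ n, F (n + 1) →ₗ[R] F n
  /-- the augmentation -/
  augmentation : F 0 →ₗ[R] M
  augmentation_surjective : Function.Surjective augmentation
  exact_zero : Function.Exact (d 0) augmentation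
  exact_succ : ∀ n, Function.Exact (d (n + 1)) (d n)
  minimal : ∀ n, LinearMap.range (d n) ≤ IsLocalRing.maximalIdeal R • (⊤ : Submodule R (F n))

namespace MinimalFreeResolution

attribute [instance] addCommGroup module free finite

/-- The `n`-th syzygy `Ωⁿ M`: the cokernel of the differential `F (n + 1) → F n` of a minimal free
resolution of `M`. -/
abbrev syzygy {R : Type u} [CommRing R] [IsLocalRing R] {M : Type u} [AddCommGroup M] [Module R M]
    (P : MinimalFreeResolution R M) (n : ℕ) : Type u :=
  P.F n ⧸ LinearMap.range (P.d n)

end MinimalFreeResolution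

/-! Since `i` is below the depth, `Ext^a(k, R) = 0` for all `a ≤ i`. Dualizing the start of the
resolution therefore gives an exact sequence `0 → F₀* → ⋯ → F_{i-1}* → (Ωⁱk)* → 0`, whose first map
has entries in `𝔪`; by Nakayama it cannot split, so `(Ωⁱk)*` has projective dimension exactly `i -
1` (`hasProjectiveDimensionLT_dual_syzygy`). If `(Ωⁱk)* ≅ Ωⁱk`, shifting back along the resolution
gives `pd k = i + (i - 1) = 2i - 1`.

Finiteness of `pd k` forces regularity (Serre). In `exists_isRegular_ofList_eq_maximalIdeal` one
finds a regular `x ∈ 𝔪 \ 𝔪²`, passes to `R/x`, whose residue field is a retract of `𝔪/x𝔪` and so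
again has finite projective dimension, and inducts on dimension. The resulting regular sequence
generates `𝔪`, and its length is at once the dimension, the depth and `pd k`. -/

open CategoryTheory IsLocalRing Pointwise TensorProduct Abelian RingTheory.Sequence

/-! ### Finite projective dimension of the residue field (Serre's theorem) -/

section ResidueFieldProjectiveDimension

variable {R : Type u} [CommRing R] [IsLocalRing R]

/-- A finite module over a local ring has a finite free cover with kernel inside `𝔪` times the
cover. -/
lemma Module.exists_minimal_cover (M : Type u) [AddCommGroup M] [Module R M] [Module.Finite R M] :
    ∃ (n : ℕ) (f : (Fin n → R) →ₗ[R] M), Function.Surjective f ∧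
      ∀ c, f c = 0 → ∀ i, c i ∈ maximalIdeal R := by
  let b := Module.finBasis (ResidueField R) (ResidueField R ⊗[R] M)
  have hs : Function.Surjective (TensorProduct.mk R (ResidueField R) M 1) :=
    TensorProduct.mk_surjective R M (ResidueField R) residue_surjective
  choose v hv using fun i ↦ hs (b i)
  refine ⟨_, Fintype.linearCombination R v, ?_, fun c hc i ↦ ?_⟩
  · rw [← LinearMap.range_eq_top, Fintype.range_linearCombination]
    exact span_eq_top_of_tmul_eq_basis v b hv
  · have h : ∑ j, residue R (c j) • b j = 0 := by
      have := congrArg (TensorProduct.mk R (ResidueField R) M 1) hc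
      rw [Fintype.linearCombination_apply, map_sum, map_zero] at this
      rw [← this]
      refine Finset.sum_congr rfl fun j _ ↦ ?_
      rw [map_smul, hv]
      exact (algebraMap_smul (ResidueField R) (c j) (b j))
    exact (residue_eq_zero_iff _).mp
      (Fintype.linearIndependent_iff.mp b.linearIndependent _ h i)

variable [IsNoetherianRing R]

/-- If some nonzero element of `R` is killed by the maximal ideal, every finite module of finite
projective dimension is free. -/
lemma Module.free_of_hasProjectiveDimensionLT_of_socle {x : R} (hx : x ≠ 0)
    (hxm : ∀ r ∈ maximalIdeal R, x * r = 0) (n : ℕ) (M : Type u) [AddCommGroup M] [Module R M]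
    [Module.Finite R M] (h : HasProjectiveDimensionLT (ModuleCat.of R M) (n + 1)) :
    Module.Free R M := by
  induction n generalizing M with
  | zero =>
    have := projective_iff_hasProjectiveDimensionLT_one.mpr h
    have : Module.Projective R M := (IsProjective.iff_projective M).mpr this
    exact Module.free_of_flat_of_isLocalRing
  | succ n ih =>
    obtain ⟨k, f, hf, hk⟩ := Module.exists_minimal_cover (R := R) M
    have hS := LinearMap.shortExact_shortComplexKer hf
    have hp : CategoryTheory.Projective f.shortComplexKer.X₂ := ModuleCat.projective_of_free (Pi.basisFun R (Fin k))
    have hN := (hS.hasProjectiveDimensionLT_X₃_iff n hp).mp h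
    have hfree : Module.Free R (LinearMap.ker f) := ih (LinearMap.ker f) hN
    -- By minimality the kernel has coordinates in `𝔪`, so `x` kills it; a nonzero free module is
    -- faithful, so the kernel vanishes.
    have hz : ∀ y : LinearMap.ker f, x • y = 0 := fun y ↦ by
      ext i
      exact hxm _ (hk _ y.2 i)
    have hsub : Subsingleton (LinearMap.ker f) := by
      by_contra hns
      have := not_subsingleton_iff_nontrivial.mp hns
      have hbot : Module.annihilator R (LinearMap.ker f) = ⊥ :=
        Module.annihilator_eq_bot.mpr inferInstance
      have hann := Module.mem_annihilator.mpr hz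
      rw [hbot] at hann
      exact hx hann
    have hinj : Function.Injective f := by
      rw [← LinearMap.ker_eq_bot, ← Submodule.subsingleton_iff_eq_bot]
      exact hsub
    exact Module.Free.of_equiv (LinearEquiv.ofBijective f ⟨hinj, hf⟩)

/-- Reducing modulo a regular element does not increase the projective dimension. -/
lemma hasProjectiveDimensionLT_quotSMulTop {x : R} (hxR : IsSMulRegular R x) (n : ℕ)
    (M : Type u) [AddCommGroup M] [Module R M] [Module.Finite R M] (hM : IsSMulRegular M x)
    (h : HasProjectiveDimensionLT (ModuleCat.of R M) (n + 1)) :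
    HasProjectiveDimensionLT (ModuleCat.of (R ⧸ Ideal.span {x}) (QuotSMulTop x M)) (n + 1) := by
  induction n generalizing M with
  | zero =>
    have := projective_iff_hasProjectiveDimensionLT_one.mpr h
    have : Module.Projective R M := (IsProjective.iff_projective M).mpr this
    have : Module.Free R M := Module.free_of_flat_of_isLocalRing
    refine projective_iff_hasProjectiveDimensionLT_one.mp ?_
    exact (IsProjective.iff_projective _).mp inferInstance
  | succ n ih =>
    obtain ⟨k, f, hf, -⟩ := Module.exists_minimal_cover (R := R) M
    have hS := LinearMap.shortExact_shortComplexKer hf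
    have hp : CategoryTheory.Projective f.shortComplexKer.X₂ := ModuleCat.projective_of_free (Pi.basisFun R (Fin k))
    have hN := (hS.hasProjectiveDimensionLT_X₃_iff n hp).mp h
    have hF : IsSMulRegular (Fin k → R) x := IsSMulRegular.pi fun _ ↦ hxR
    have ih' := ih (LinearMap.ker f) (hF.submodule (LinearMap.ker f) x) hN
    let S := R ⧸ Ideal.span {x}
    let a : QuotSMulTop x (LinearMap.ker f) →ₗ[S] QuotSMulTop x (Fin k → R) :=
      (QuotSMulTop.map x (LinearMap.ker f).subtype).extendScalarsOfSurjective
        Ideal.Quotient.mk_surjective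
    let b : QuotSMulTop x (Fin k → R) →ₗ[S] QuotSMulTop x M :=
      (QuotSMulTop.map x f).extendScalarsOfSurjective Ideal.Quotient.mk_surjective
    have hb : Function.Surjective b := QuotSMulTop.map_surjective x hf
    have hab : Function.Exact a b :=
      QuotSMulTop.map_exact x (LinearMap.exact_subtype_ker_map f) hf
    -- This is the vanishing of `Tor₁(M, R/x)`, which holds because `x` is regular on `M`.
    have ha : Function.Injective a := by
      rw [injective_iff_map_eq_zero]
      intro y hy
      obtain ⟨y, rfl⟩ := Submodule.Quotient.mk_surjective _ y
      have hy' : (Submodule.Quotient.mk (y : Fin k → R) : QuotSMulTop x (Fin k → R)) = 0 := hy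
      rw [Submodule.Quotient.mk_eq_zero, Submodule.mem_smul_pointwise_iff_exists] at hy'
      obtain ⟨z, -, hz⟩ := hy'
      rw [Submodule.Quotient.mk_eq_zero, Submodule.mem_smul_pointwise_iff_exists]
      refine ⟨⟨z, ?_⟩, trivial, Subtype.ext hz⟩
      refine hM.right_eq_zero_of_smul ?_
      rw [← map_smul, hz]
      exact y.2
    have hS' : (ModuleCat.shortComplexOfCompEqZero a b hab.linearMap_comp_eq_zero).ShortExact :=
      { exact := ModuleCat.shortComplex_exact _ hab
        mono_f := (ModuleCat.mono_iff_injective _).mpr ha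
        epi_g := (ModuleCat.epi_iff_surjective _).mpr hb }
    refine hS'.hasProjectiveDimensionLT_X₃ (n + 1) ih' ?_
    have : Projective (ModuleCat.of S (QuotSMulTop x (Fin k → R))) :=
      (IsProjective.iff_projective _).mp inferInstance
    exact hasProjectiveDimensionLT_of_ge _ 1 _ (by lia)

/-- If the residue field has finite projective dimension and the maximal ideal is nonzero, there is
a regular element in `𝔪 \ 𝔪²`. -/
lemma exists_isSMulRegular_notMem_sq {n : ℕ}
    (h : HasProjectiveDimensionLT (ModuleCat.of R (ResidueField R)) (n + 1))
    (hm : maximalIdeal R ≠ ⊥) :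
    ∃ x ∈ maximalIdeal R, x ∉ maximalIdeal R ^ 2 ∧ IsSMulRegular R x := by
  by_contra! hcon
  have hfin : (insert (maximalIdeal R ^ 2) (associatedPrimes R R)).Finite :=
    (associatedPrimes.finite R R).insert _
  have hsub : (maximalIdeal R : Set R) ⊆
      ⋃ p ∈ insert (maximalIdeal R ^ 2) (associatedPrimes R R), (id p : Ideal R) := by
    intro x hx
    rw [Set.biUnion_insert]
    by_cases hx2 : x ∈ maximalIdeal R ^ 2
    · exact Or.inl hx2
    · refine Or.inr ?_
      have := hcon x hx hx2
      have h' := biUnion_associatedPrimes_eq_compl_regular R R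
      simp only [id]
      rw [h']
      exact this
  -- Prime avoidance tolerates two non-prime ideals; `𝔪²` fills both slots.
  obtain ⟨p, hp, hle⟩ := (Ideal.subset_union_prime_finite hfin (f := id) (maximalIdeal R ^ 2)
    (maximalIdeal R ^ 2) (fun p hp hne _ ↦ by
      rcases hp with hp | hp
      · exact absurd hp hne
      · exact hp.isPrime)).mp hsub
  rcases hp with rfl | hp
  · apply hm
    refine Submodule.eq_bot_of_le_smul_of_le_jacobson_bot (maximalIdeal R) _
      (maximalIdeal R).fg_of_isNoetherianRing ?_ (IsLocalRing.maximalIdeal_le_jacobson _)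
    simpa [pow_two] using hle
  -- If `𝔪` is associated to `R`, a socle element exists, so `k` is free, hence faithful, and `𝔪 =
  -- 0`.
  · have hpm : p = maximalIdeal R :=
      ((maximalIdeal.isMaximal R).eq_of_le hp.isPrime.ne_top hle).symm
    subst hpm
    rw [AssociatedPrimes.mem_iff, isAssociatedPrime_iff] at hp
    obtain ⟨-, x, hx⟩ := hp
    have hxm : ∀ r ∈ maximalIdeal R, x * r = 0 := fun r hr ↦ by
      rw [hx] at hr
      simpa [Submodule.mem_colon_singleton, mul_comm] using hr
    have hx0 : x ≠ 0 := by
      rintro rfl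
      exact (maximalIdeal.isMaximal R).ne_top (by rw [hx]; simp)
    have hfree := Module.free_of_hasProjectiveDimensionLT_of_socle hx0 hxm n (ResidueField R) h
    apply hm
    rw [eq_bot_iff]
    intro r hr
    have hann : r ∈ Module.annihilator R (ResidueField R) := by
      rw [Module.mem_annihilator]
      intro y
      rw [← algebraMap_smul (ResidueField R) r y]
      have : algebraMap R (ResidueField R) r = 0 := (residue_eq_zero_iff r).mpr hr
      rw [this, zero_smul]
    have hbot : Module.annihilator R (ResidueField R) = ⊥ := Module.annihilator_eq_bot.mpr
      inferInstance
    rwa [hbot] at hann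

/-- For `x ∈ 𝔪 \ 𝔪²`, the residue field of `R/x` is a retract of `𝔪/x𝔪`. -/
lemma hasProjectiveDimensionLT_residueField_quotient {x : R} (hx : x ∈ maximalIdeal R)
    (hx2 : x ∉ maximalIdeal R ^ 2) [IsLocalRing (R ⧸ Ideal.span {x})] (n : ℕ)
    (h : HasProjectiveDimensionLT
      (ModuleCat.of (R ⧸ Ideal.span {x}) (QuotSMulTop x (maximalIdeal R))) n) :
    HasProjectiveDimensionLT
      (ModuleCat.of (R ⧸ Ideal.span {x}) (ResidueField (R ⧸ Ideal.span {x}))) n := by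
  let S := R ⧸ Ideal.span {x}
  have hloc : IsLocalHom (algebraMap R S) :=
    IsLocalHom.of_surjective _ Ideal.Quotient.mk_surjective
  let ξ : CotangentSpace R := (maximalIdeal R).toCotangent ⟨x, hx⟩
  have hξ : ξ ≠ 0 := by
    intro h0
    exact hx2 ((Ideal.toCotangent_eq_zero _ _).mp h0)
  obtain ⟨g, hg⟩ : ∃ g : Module.Dual (ResidueField R) (CotangentSpace R), g ξ ≠ 0 := by
    by_contra! hcon
    exact hξ ((Module.forall_dual_apply_eq_zero_iff (ResidueField R) ξ).mp hcon)
  -- A functional on `𝔪/𝔪²` normalized to take the value `1` at the class of `x`; it will split the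
  -- map sending `1` to that class.
  let φ : maximalIdeal R →ₗ[R] ResidueField S :=
    (IsScalarTower.toAlgHom R (ResidueField R) (ResidueField S)).toLinearMap ∘ₗ
      ((g ξ)⁻¹ • g).restrictScalars R ∘ₗ (maximalIdeal R).toCotangent
  have hφ : φ ⟨x, hx⟩ = 1 := by
    have : (g ξ)⁻¹ * g ξ = 1 := inv_mul_cancel₀ hg
    change algebraMap (ResidueField R) (ResidueField S) ((g ξ)⁻¹ * g ξ) = 1
    rw [this, map_one]
  have hxz : ∀ y : ResidueField S, x • y = 0 := fun y ↦ by
    rw [← algebraMap_smul S x y]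
    have : algebraMap R S x = 0 :=
      Ideal.Quotient.eq_zero_iff_mem.mpr (Ideal.mem_span_singleton_self x)
    rw [this, zero_smul]
  let ρ : QuotSMulTop x (maximalIdeal R) →ₗ[S] ResidueField S :=
    (Submodule.liftQ _ φ (by
      intro y hy
      obtain ⟨z, -, rfl⟩ := (Submodule.mem_smul_pointwise_iff_exists _ _ _).mp hy
      rw [LinearMap.mem_ker, map_smul, hxz])).extendScalarsOfSurjective
      Ideal.Quotient.mk_surjective
  let ξ' : QuotSMulTop x (maximalIdeal R) := Submodule.Quotient.mk ⟨x, hx⟩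
  let σ : ResidueField S →ₗ[S] QuotSMulTop x (maximalIdeal R) :=
    Submodule.liftQ (maximalIdeal S) (LinearMap.toSpanSingleton S _ ξ') (by
      intro s hs
      obtain ⟨r, rfl⟩ := Ideal.Quotient.mk_surjective s
      have hr : r ∈ maximalIdeal R := by
        rw [mem_maximalIdeal, mem_nonunits_iff] at hs ⊢
        exact fun hu ↦ hs (hu.map (Ideal.Quotient.mk _))
      rw [LinearMap.mem_ker, LinearMap.toSpanSingleton_apply]
      change (Submodule.Quotient.mk (r • (⟨x, hx⟩ : maximalIdeal R)) :
        QuotSMulTop x (maximalIdeal R)) = 0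
      rw [Submodule.Quotient.mk_eq_zero, Submodule.mem_smul_pointwise_iff_exists]
      exact ⟨⟨r, hr⟩, trivial, Subtype.ext (mul_comm _ _)⟩)
  have hρσ : ρ ∘ₗ σ = LinearMap.id := by
    refine Submodule.linearMap_qext _ (LinearMap.ext_ring ?_)
    change ρ ((1 : S) • ξ') = 1
    rw [one_smul]
    exact hφ
  exact (Retract.mk (ModuleCat.ofHom σ) (ModuleCat.ofHom ρ)
    (ModuleCat.hom_ext hρσ)).hasProjectiveDimensionLT n

/-- A noetherian local ring whose residue field has finite projective dimension has its maximal
ideal generated by a regular sequence. -/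
theorem exists_isRegular_ofList_eq_maximalIdeal (d : ℕ) (R : Type u) [CommRing R] [IsLocalRing R]
    [IsNoetherianRing R] (hd : ringKrullDim R < d) (n : ℕ)
    (h : HasProjectiveDimensionLT (ModuleCat.of R (ResidueField R)) (n + 1)) :
    ∃ rs : List R, IsRegular R rs ∧ Ideal.ofList rs = maximalIdeal R := by
  -- The bound on the dimension is strict, so the base case is vacuous.
  induction d generalizing R with
  | zero => exact absurd ringKrullDim_nonneg_of_nontrivial (not_le.mpr hd)
  | succ d ih =>
    by_cases hm : maximalIdeal R = ⊥
    · exact ⟨[], IsRegular.nil R R, by simp [hm]⟩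
    obtain ⟨x, hx, hx2, hreg⟩ := exists_isSMulRegular_notMem_sq h hm
    have hnt : Nontrivial (R ⧸ Ideal.span {x}) :=
      Ideal.Quotient.nontrivial_iff.mpr fun htop ↦ hx (Ideal.span_singleton_eq_top.mp htop)
    have hloc : IsLocalRing (R ⧸ Ideal.span {x}) :=
      IsLocalRing.of_surjective' _ Ideal.Quotient.mk_surjective
    have hdim : ringKrullDim (R ⧸ Ideal.span {x}) < d := by
      rw [← ringKrullDim_quotient_span_singleton_succ_eq_ringKrullDim hreg hx,
        Nat.cast_add, Nat.cast_one] at hd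
      exact lt_of_add_lt_add_right hd
    -- The sequence `0 → 𝔪 → R → k → 0` moves the bound from `k` to `𝔪`, on which `x` is regular,
    -- unlike on `k`.
    have hker : HasProjectiveDimensionLT (ModuleCat.of R (maximalIdeal R)) (n + 1) := by
      have hS : (ModuleCat.shortComplexOfCompEqZero (maximalIdeal R).subtype
          (maximalIdeal R).mkQ (LinearMap.exact_subtype_mkQ _).linearMap_comp_eq_zero).ShortExact :=
        { exact := ModuleCat.shortComplex_exact _ (LinearMap.exact_subtype_mkQ _)
          mono_f := (ModuleCat.mono_iff_injective _).mpr (Submodule.injective_subtype _)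
          epi_g := (ModuleCat.epi_iff_surjective _).mpr (Submodule.mkQ_surjective _) }
      have : CategoryTheory.Projective (ModuleCat.of R R) :=
        (IsProjective.iff_projective _).mp inferInstance
      exact hS.hasProjectiveDimensionLT_X₁ (n + 1) (hasProjectiveDimensionLT_of_ge _ 1 _ (by lia))
        (hasProjectiveDimensionLT_of_ge (ModuleCat.of R (ResidueField R)) (n + 1) _ (by lia))
    obtain ⟨rs, hrs, hmax⟩ := ih (R ⧸ Ideal.span {x}) hdim
      (hasProjectiveDimensionLT_residueField_quotient hx hx2 (n + 1)
        (hasProjectiveDimensionLT_quotSMulTop hreg n _ (hreg.submodule _ x) hker))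
    let rs' : List R := rs.map (Function.surjInv Ideal.Quotient.mk_surjective)
    have hrs' : rs'.map (Ideal.Quotient.mk (Ideal.span {x})) = rs := by
      simp [rs', Function.comp_def, Function.surjInv_eq]
    refine ⟨x :: rs', (isRegular_cons_iff' R x rs').mpr ⟨hreg, ?_⟩, ?_⟩
    · rw [hrs']
      let e : QuotSMulTop x R ≃ₗ[R ⧸ Ideal.span {x}] (R ⧸ Ideal.span {x}) :=
        (Submodule.quotEquivOfEq _ _ (by
          rw [← Submodule.ideal_span_singleton_smul]
          simp)).extendScalarsOfSurjective Ideal.Quotient.mk_surjective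
      exact (e.isRegular_congr rs).mpr hrs
    · have hmap : (Ideal.ofList rs').map (Ideal.Quotient.mk (Ideal.span {x})) =
          maximalIdeal (R ⧸ Ideal.span {x}) := by
        rw [Ideal.map_ofList, hrs', hmax]
      rw [Ideal.ofList_cons, sup_comm]
      have hcomap := congrArg (Ideal.comap (Ideal.Quotient.mk (Ideal.span {x}))) hmap
      rw [Ideal.comap_map_of_surjective _ Ideal.Quotient.mk_surjective, ← RingHom.ker,
        Ideal.mk_ker] at hcomap
      rw [hcomap]
      exact IsLocalRing.eq_maximalIdeal
        (Ideal.comap_isMaximal_of_surjective _ Ideal.Quotient.mk_surjective)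

end ResidueFieldProjectiveDimension

/-- A functional on a finite free module with values in `I` lies in `I` times the dual. -/
lemma Module.Dual.mem_smul_top_of_forall_apply_mem {R F : Type u} [CommRing R]
    [AddCommGroup F] [Module R F] [Module.Free R F] [Module.Finite R F] (I : Ideal R) (φ : Module.Dual R F) (h : ∀ y, φ y ∈ I) :
    φ ∈ I • (⊤ : Submodule R (Module.Dual R F)) := by
  let b := Module.Free.chooseBasis R F
  rw [← b.sum_dual_apply_smul_coord φ]
  exact Submodule.sum_mem _ fun i _ ↦ Submodule.smul_mem_smul (h _) trivial

/-! ### Syzygies of the residue field and their duals -/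

section Syzygies

variable {R : Type u} [CommRing R] [IsLocalRing R]

/-- `Ext^j(k, N) = 0` for `j` below the length of an `N`-regular sequence in `𝔪`. -/
lemma subsingleton_ext_residueField (rs : List R) (hrs : ∀ r ∈ rs, r ∈ maximalIdeal R)
    (N : Type u) [AddCommGroup N] [Module R N] (h : IsWeaklyRegular N rs) (j : ℕ)
    (hj : j < rs.length) :
    Subsingleton (Ext (ModuleCat.of R (ResidueField R)) (ModuleCat.of R N) j) := by
  induction rs generalizing N j with
  | nil => simp at hj
  | cons x rs ih =>
    rw [isWeaklyRegular_cons_iff] at h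
    have hS := IsSMulRegular.smulShortComplex_shortExact (M := ModuleCat.of R N) h.1
    have hx : x • 𝟙 (ModuleCat.of R (ResidueField R)) = 0 := by
      ext y
      change x • y = 0
      rw [← algebraMap_smul (ResidueField R) x y]
      have : algebraMap R (ResidueField R) x = 0 := (residue_eq_zero_iff x).mpr (hrs x (by simp))
      rw [this, zero_smul]
    refine subsingleton_of_forall_eq 0 fun e ↦ ?_
    -- Multiplication by `x` on `Ext` can be computed in either variable, and it is zero on `k`.
    have he : e.comp (Ext.mk₀ ((ModuleCat.of R N).smulShortComplex x).f) (add_zero j) = 0 := by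
      change e.comp (Ext.mk₀ (x • 𝟙 (ModuleCat.of R N))) (add_zero j) = 0
      rw [Ext.mk₀_smul, Ext.comp_smul, Ext.comp_mk₀_id,
        ← Ext.mk₀_id_comp e, ← Ext.smul_comp, ← Ext.mk₀_smul, hx, Ext.mk₀_zero, Ext.zero_comp]
    match j with
    | 0 =>
      have := hS.mono_f
      refine Ext.postcomp_mk₀_injective_of_mono (ModuleCat.of R (ResidueField R))
        ((ModuleCat.of R N).smulShortComplex x).f ?_
      exact he.trans (map_zero _).symm
    | j + 1 =>
      -- Being killed by `x`, the class comes from `Ext^j(k, N/xN)`, which vanishes by induction.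
      obtain ⟨y, rfl⟩ := Ext.covariant_sequence_exact₁ _ hS e he rfl
      have := ih (fun r hr ↦ hrs r (by simp [hr])) (QuotSMulTop x N) h.2 j (by simpa using hj)
      have hy : y = 0 := Subsingleton.elim (α := Ext (ModuleCat.of R (ResidueField R))
        (ModuleCat.of R (QuotSMulTop x N)) j) _ _
      rw [hy]
      exact Ext.zero_comp _ _ hS.extClass _ _

namespace MinimalFreeResolution

variable {M : Type u} [AddCommGroup M] [Module R M] (P : MinimalFreeResolution R M)

/-- The zeroth syzygy is the resolved module. -/
noncomputable def syzygyZeroEquiv : P.syzygy 0 ≃ₗ[R] M :=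
  Submodule.quotEquivOfEq _ _ P.exact_zero.linearMap_ker_eq.symm ≪≫ₗ
    P.augmentation.quotKerEquivOfSurjective P.augmentation_surjective

/-- The inclusion of a syzygy in the preceding free module. -/
def syzygyInclusion (n : ℕ) : P.syzygy (n + 1) →ₗ[R] P.F n :=
  Submodule.liftQ _ (P.d n) (P.exact_succ n).linearMap_ker_eq.ge

lemma syzygyInclusion_injective (n : ℕ) : Function.Injective (P.syzygyInclusion n) := by
  rw [← LinearMap.ker_eq_bot]
  exact Submodule.ker_liftQ_eq_bot _ _ _ (P.exact_succ n).linearMap_ker_eq.le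

lemma range_syzygyInclusion (n : ℕ) :
    LinearMap.range (P.syzygyInclusion n) = LinearMap.range (P.d n) :=
  Submodule.range_liftQ _ _ _

lemma exact_syzygyInclusion_mkQ (n : ℕ) :
    Function.Exact (P.syzygyInclusion n) (LinearMap.range (P.d n)).mkQ := by
  rw [LinearMap.exact_iff, Submodule.ker_mkQ, range_syzygyInclusion]

/-- The short complex `0 → Ωⁿ⁺¹ → F n → Ωⁿ → 0`. -/
abbrev syzygyShortComplex (n : ℕ) : ShortComplex (ModuleCat.{u} R) :=
  ModuleCat.shortComplexOfCompEqZero (P.syzygyInclusion n) (LinearMap.range (P.d n)).mkQ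
    (P.exact_syzygyInclusion_mkQ n).linearMap_comp_eq_zero

lemma syzygyShortComplex_shortExact (n : ℕ) : (P.syzygyShortComplex n).ShortExact where
  exact := ModuleCat.shortComplex_exact _ (P.exact_syzygyInclusion_mkQ n)
  mono_f := (ModuleCat.mono_iff_injective _).mpr (P.syzygyInclusion_injective n)
  epi_g := (ModuleCat.epi_iff_surjective _).mpr (Submodule.mkQ_surjective _)

instance (n : ℕ) : CategoryTheory.Projective (P.syzygyShortComplex n).X₂ :=
  (IsProjective.iff_projective (P.F n)).mp inferInstance

/-- Dimension shifting: the middle term of `syzygyShortComplex` is projective. -/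
lemma hasProjectiveDimensionLT_syzygy_iff (n j : ℕ) :
    HasProjectiveDimensionLT (ModuleCat.of R (P.syzygy j)) (n + 1) ↔
      HasProjectiveDimensionLT (ModuleCat.of R M) (j + n + 1) := by
  induction j generalizing n with
  | zero =>
    rw [show 0 + n + 1 = n + 1 by lia]
    exact ⟨fun _ ↦ hasProjectiveDimensionLT_of_iso P.syzygyZeroEquiv.toModuleIso _,
      fun _ ↦ hasProjectiveDimensionLT_of_iso P.syzygyZeroEquiv.symm.toModuleIso _⟩
  | succ j ih =>
    rw [show j + 1 + n + 1 = j + (n + 1) + 1 by lia, ← ih]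
    exact ((P.syzygyShortComplex_shortExact j).hasProjectiveDimensionLT_X₃_iff n
      inferInstance).symm

variable {t : ℕ}

/-- Dimension shifting again: `Ext^a(Ωʲ⁺¹, R)` is squeezed between `Ext^a(F j, R)`, zero as `a ≥ 1`,
and `Ext^{a+1}(Ωʲ, R)`. -/
lemma subsingleton_ext_syzygy
    (hext : ∀ a < t, Subsingleton (Ext (ModuleCat.of R M) (ModuleCat.of R R) a)) (j a : ℕ)
    (ha : 1 ≤ a) (haj : a + j < t) :
    Subsingleton (Ext (ModuleCat.of R (P.syzygy j)) (ModuleCat.of R R) a) := by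
  refine subsingleton_of_forall_eq 0 fun e ↦ ?_
  induction j generalizing a with
  | zero =>
    have := hext a haj
    have hiso : (Ext.mk₀ P.syzygyZeroEquiv.toModuleIso.hom).comp
        ((Ext.mk₀ P.syzygyZeroEquiv.toModuleIso.inv).comp e (zero_add a)) (zero_add a) = e := by
      rw [Ext.mk₀_comp_mk₀_assoc, Iso.hom_inv_id, Ext.mk₀_id_comp]
    rw [← hiso, Subsingleton.elim ((Ext.mk₀ P.syzygyZeroEquiv.toModuleIso.inv).comp e (zero_add a))
      0, Ext.comp_zero]
  | succ j ih =>
    obtain ⟨y, rfl⟩ := Ext.contravariant_sequence_exact₁ (P.syzygyShortComplex_shortExact j) _ e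
      (add_comm 1 a) (ih (a + 1) (by lia) (by lia) _)
    have hy : y = 0 := by
      obtain ⟨b, rfl⟩ := Nat.exists_eq_add_of_le' ha
      exact Ext.eq_zero_of_projective y
    rw [hy, Ext.comp_zero]

/-- Functionals on a syzygy extend to the preceding free module while `Ext` into `R` vanishes. -/
lemma dualMap_syzygyInclusion_surjective
    (hext : ∀ a < t, Subsingleton (Ext (ModuleCat.of R M) (ModuleCat.of R R) a)) (j : ℕ)
    (hj : j + 1 < t) : Function.Surjective (P.syzygyInclusion j).dualMap := by
  intro φ
  have := P.subsingleton_ext_syzygy hext j 1 le_rfl (by lia)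
  obtain ⟨y, hy⟩ := Ext.contravariant_sequence_exact₁ (P.syzygyShortComplex_shortExact j) _
    (Ext.mk₀ (ModuleCat.ofHom φ)) (add_zero 1)
    (Subsingleton.elim (α := Ext (ModuleCat.of R (P.syzygy j)) (ModuleCat.of R R) 1) _ _)
  obtain ⟨ψ, rfl⟩ := (Ext.mk₀_bijective _ _).2 y
  rw [Ext.mk₀_comp_mk₀, (Ext.mk₀_bijective _ _).1.eq_iff] at hy
  exact ⟨ψ.hom, congrArg ModuleCat.Hom.hom hy⟩

lemma exact_dualMap_syzygy (j : ℕ) : Function.Exact (LinearMap.range (P.d j)).mkQ.dualMap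
    (P.syzygyInclusion j).dualMap := by
  intro φ
  constructor
  · intro h
    refine ⟨Submodule.liftQ _ φ ?_, LinearMap.ext fun _ ↦ rfl⟩
    rintro _ ⟨y, rfl⟩
    exact LinearMap.congr_fun h (Submodule.Quotient.mk y)
  · rintro ⟨ψ, rfl⟩
    ext y
    change ψ (Submodule.Quotient.mk (P.d j y)) = 0
    rw [(Submodule.Quotient.mk_eq_zero _).mpr (LinearMap.mem_range_self _ _), map_zero]

/-- The dual `0 → (Ωʲ)* → (F j)* → (Ωʲ⁺¹)* → 0` of `syzygyShortComplex`. -/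
abbrev dualSyzygyShortComplex (j : ℕ) : ShortComplex (ModuleCat.{u} R) :=
  ModuleCat.shortComplexOfCompEqZero (LinearMap.range (P.d j)).mkQ.dualMap
    (P.syzygyInclusion j).dualMap (P.exact_dualMap_syzygy j).linearMap_comp_eq_zero

lemma dualSyzygyShortComplex_shortExact
    (hext : ∀ a < t, Subsingleton (Ext (ModuleCat.of R M) (ModuleCat.of R R) a)) (j : ℕ)
    (hj : j + 1 < t) : (P.dualSyzygyShortComplex j).ShortExact where
  exact := ModuleCat.shortComplex_exact _ (P.exact_dualMap_syzygy j)
  mono_f := (ModuleCat.mono_iff_injective _).mpr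
    (LinearMap.dualMap_injective_of_surjective (Submodule.mkQ_surjective _))
  epi_g := (ModuleCat.epi_iff_surjective _).mpr (P.dualMap_syzygyInclusion_surjective hext j hj)

instance (j : ℕ) : CategoryTheory.Projective (P.dualSyzygyShortComplex j).X₂ :=
  (IsProjective.iff_projective (Module.Dual R (P.F j))).mp inferInstance

/-- For `2 ≤ j < t` the projective dimension of `(Ωʲ)*` is `j - 1`. -/
lemma hasProjectiveDimensionLT_dual_syzygy [Nontrivial M]
    (hext : ∀ a < t, Subsingleton (Ext (ModuleCat.of R M) (ModuleCat.of R R) a)) (l : ℕ)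
    (hl : l + 2 < t) :
    HasProjectiveDimensionLT (ModuleCat.of R (Module.Dual R (P.syzygy (l + 2)))) (l + 2) ∧
    ¬ HasProjectiveDimensionLT (ModuleCat.of R (Module.Dual R (P.syzygy (l + 2)))) (l + 1) := by
  induction l with
  | zero =>
    have hsurj := P.dualMap_syzygyInclusion_surjective hext 0 (by lia)
    -- The case `a = 0` of the vanishing gives `M* = 0`, so `(F 0)* ≅ (Ω¹)*` and the latter is free.
    have hM : Subsingleton (Module.Dual R M) := by
      have h0 := hext 0 (by lia)
      refine subsingleton_of_forall_eq 0 fun φ ↦ ?_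
      exact congrArg ModuleCat.Hom.hom ((Ext.mk₀_bijective (ModuleCat.of R M) (ModuleCat.of R R)).1
        (Subsingleton.elim (Ext.mk₀ (ModuleCat.ofHom φ)) (Ext.mk₀ 0)))
    have hΩ : Subsingleton (Module.Dual R (P.syzygy 0)) :=
      P.syzygyZeroEquiv.dualMap.symm.injective.subsingleton
    have hinj : Function.Injective (P.syzygyInclusion 0).dualMap := by
      rw [injective_iff_map_eq_zero]
      intro φ hφ
      obtain ⟨ψ, rfl⟩ := (P.exact_dualMap_syzygy 0 φ).mp hφ
      rw [Subsingleton.elim ψ 0, map_zero]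
    let e := LinearEquiv.ofBijective _ ⟨hinj, hsurj⟩
    have hfree : Module.Free R (Module.Dual R (P.syzygy 1)) := Module.Free.of_equiv e
    have hfin : Module.Finite R (Module.Dual R (P.syzygy 1)) := Module.Finite.equiv e
    have hproj : CategoryTheory.Projective (ModuleCat.of R (Module.Dual R (P.syzygy 1))) :=
      (IsProjective.iff_projective _).mp inferInstance
    have hS := P.dualSyzygyShortComplex_shortExact hext 1 (by lia)
    refine ⟨hS.hasProjectiveDimensionLT_X₃ 1
      (projective_iff_hasProjectiveDimensionLT_one.mp hproj)
      (hasProjectiveDimensionLT_of_ge _ 1 _ (by lia)), fun h ↦ ?_⟩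
    have hproj2 : Module.Projective R (Module.Dual R (P.syzygy 2)) :=
      (IsProjective.iff_projective _).mpr (projective_iff_hasProjectiveDimensionLT_one.mpr h)
    obtain ⟨s, hs⟩ := Module.projective_lifting_property (P.syzygyInclusion 1).dualMap
      LinearMap.id (P.dualMap_syzygyInclusion_surjective hext 1 (by lia))
    have hsplit := (P.exact_dualMap_syzygy 1).split_tfae'.out 0 1
    obtain ⟨-, r, hr⟩ := hsplit.mp
      ⟨LinearMap.dualMap_injective_of_surjective (Submodule.mkQ_surjective _), s, hs⟩
    -- The composite `(F 0)* → (Ω¹)* → (F 1)*` is the dual of `d 0`, with image in `𝔪 (F 1)*`. The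
    -- retraction `r` carries this back to `(Ω¹)* = 𝔪 (Ω¹)*`.
    have htop : (⊤ : Submodule R (Module.Dual R (P.syzygy 1))) ≤ maximalIdeal R • ⊤ := by
      intro φ _
      obtain ⟨ψ, rfl⟩ := hsurj φ
      have hmem : (LinearMap.range (P.d 1)).mkQ.dualMap ((P.syzygyInclusion 0).dualMap ψ) ∈
          maximalIdeal R • (⊤ : Submodule R (Module.Dual R (P.F 1))) := by
        refine Module.Dual.mem_smul_top_of_forall_apply_mem _ _ fun y ↦ ?_
        change ψ (P.d 0 y) ∈ _
        have : ψ (P.d 0 y) ∈ (maximalIdeal R • (⊤ : Submodule R (P.F 0))).map ψ :=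
          Submodule.mem_map_of_mem (P.minimal 0 (LinearMap.mem_range_self _ y))
        rw [Submodule.map_smul''] at this
        exact Ideal.mul_le_right (I := LinearMap.range ψ) (by simpa [mul_comm] using this)
      have hr' := LinearMap.congr_fun hr ((P.syzygyInclusion 0).dualMap ψ)
      rw [← LinearMap.id_apply (R := R) ((P.syzygyInclusion 0).dualMap ψ), ← hr']
      have := Submodule.mem_map_of_mem (f := r) hmem
      rw [Submodule.map_smul''] at this
      exact Submodule.smul_mono le_rfl le_top this
    have hbot := Submodule.eq_bot_of_le_smul_of_le_jacobson_bot (maximalIdeal R) ⊤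
      Module.Finite.fg_top htop (IsLocalRing.maximalIdeal_le_jacobson _)
    have hsub : Subsingleton (Module.Dual R (P.syzygy 1)) :=
      (Submodule.subsingleton_iff R).mp
        (subsingleton_iff_bot_eq_top.mp hbot.symm)
    have hF : Subsingleton (Module.Dual R (P.F 0)) := e.injective.subsingleton
    have hF0 : Subsingleton (P.F 0) := by
      refine subsingleton_of_forall_eq 0 fun y ↦ ?_
      refine (Module.forall_dual_apply_eq_zero_iff R y).mp fun φ ↦ ?_
      rw [Subsingleton.elim φ 0, LinearMap.zero_apply]
    have := P.augmentation_surjective.subsingleton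
    exact not_subsingleton M this
  | succ l ih =>
    have hS := P.dualSyzygyShortComplex_shortExact hext (l + 2) (by lia)
    obtain ⟨h₁, h₂⟩ := ih (by lia)
    exact ⟨(hS.hasProjectiveDimensionLT_X₃_iff (l + 1) inferInstance).mpr h₁,
      fun h ↦ h₂ ((hS.hasProjectiveDimensionLT_X₃_iff l inferInstance).mp h)⟩

end MinimalFreeResolution

end Syzygies

/-! ### Dimension, depth and regularity when a regular sequence generates the maximal ideal -/

section Depth

variable {R : Type u} [CommRing R] [IsLocalRing R] [IsNoetherianRing R]

lemma length_le_ringKrullDim_of_isRegular {rs : List R} (hrs : IsRegular R rs) :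
    (rs.length : WithBot ℕ∞) ≤ ringKrullDim R := by
  have hnt : Nontrivial (R ⧸ Ideal.ofList rs) :=
    Ideal.Quotient.nontrivial_iff.mpr fun h ↦ hrs.2 (by simp [h])
  rw [← ringKrullDim_add_length_eq_ringKrullDim_of_isRegular rs hrs]
  exact le_add_of_nonneg_left ringKrullDim_nonneg_of_nontrivial

variable {rs : List R} (hrs : IsRegular R rs) (hmax : Ideal.ofList rs = maximalIdeal R)
include hrs hmax

lemma ringKrullDim_eq_length_of_ofList_eq_maximalIdeal : ringKrullDim R = rs.length := by
  rw [← ringKrullDim_add_length_eq_ringKrullDim_of_isRegular rs hrs, hmax]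
  have : ringKrullDim (ResidueField R) = 0 := ringKrullDim_eq_zero_of_field _
  change ringKrullDim (ResidueField R) + _ = _
  rw [this, zero_add]

lemma isRegularLocalRing_of_ofList_eq_maximalIdeal : IsRegularLocalRing R := by
  classical
  apply IsRegularLocalRing.of_spanFinrank_maximalIdeal_le
  rw [ringKrullDim_eq_length_of_ofList_eq_maximalIdeal hrs hmax, ← hmax, Nat.cast_le]
  refine (Submodule.spanFinrank_span_le_ncard_of_finite rs.finite_toSet).trans ?_
  rw [← List.coe_toFinset, Set.ncard_coe_finset]
  exact rs.toFinset_card_le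

lemma localDepth_eq_length_of_ofList_eq_maximalIdeal : localDepth R = rs.length := by
  refine le_antisymm (iSup_le fun qs ↦ ?_) ?_
  · have := length_le_ringKrullDim_of_isRegular qs.2.1
    rw [ringKrullDim_eq_length_of_ofList_eq_maximalIdeal hrs hmax, Nat.cast_le] at this
    exact_mod_cast this
  · exact le_iSup (fun qs : {rs : List R // IsRegular R rs ∧ ∀ r ∈ rs, r ∈ maximalIdeal R} ↦
      (qs.1.length : ℕ∞)) ⟨rs, hrs, fun r hr ↦ hmax ▸ Ideal.subset_span hr⟩

/-- Each term of a regular sequence in `𝔪` raises the projective dimension of the quotient by one,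
starting from `pd R = 0`. -/
lemma hasProjectiveDimensionLT_residueField_iff (n : ℕ) :
    HasProjectiveDimensionLT (ModuleCat.of R (ResidueField R)) n ↔ rs.length < n := by
  have hmem : ∀ r ∈ rs, r ∈ maximalIdeal R := fun r hr ↦ hmax ▸ Ideal.subset_span hr
  have hpd := ModuleCat.projectiveDimension_quotient_eq_add_length_of_isWeaklyRegular
    (ModuleCat.of R R) rs hrs.1 hmem
  have h0 : projectiveDimension (ModuleCat.of R R) = 0 :=
    ModuleCat.projectiveDimension_eq_zero_of_projective (ModuleCat.of R R)
  let e : (R ⧸ Ideal.ofList rs • (⊤ : Submodule R R)) ≃ₗ[R] ResidueField R :=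
    Submodule.quotEquivOfEq _ _ (by simpa using hmax)
  rw [h0, zero_add, projectiveDimension_eq_of_iso e.toModuleIso] at hpd
  rw [← projectiveDimension_lt_iff, hpd, Nat.cast_lt]

end Depth

theorem corollary1p2 (R : Type u) [CommRing R] [IsNoetherianRing R] [IsLocalRing R]
    (ht : 3 ≤ localDepth R)
    (P : MinimalFreeResolution R (IsLocalRing.ResidueField R))
    (i : ℕ) (hi : 2 ≤ i) (hit : (i : ℕ∞) < localDepth R)
    (hself : Nonempty (Module.Dual R (P.syzygy i) ≃ₗ[R] P.syzygy i)) :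
    IsRegularLocalRing R ∧ localDepth R = ((2 * i - 1 : ℕ) : ℕ∞) := by
  obtain ⟨l, rfl⟩ := Nat.exists_eq_add_of_le' hi
  obtain ⟨e⟩ := hself
  -- One regular sequence longer than `i` suffices, so the depth need not be known to be finite or
  -- attained.
  obtain ⟨qs, hqs⟩ := lt_iSup_iff.mp hit
  obtain ⟨h₁, h₂⟩ := P.hasProjectiveDimensionLT_dual_syzygy
    (fun a ha ↦ subsingleton_ext_residueField qs.1 qs.2.2 R qs.2.1.1 a ha) l
    (by exact_mod_cast hqs)
  have h₁' : HasProjectiveDimensionLT (ModuleCat.of R (P.syzygy (l + 2))) (l + 1 + 1) :=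
    hasProjectiveDimensionLT_of_iso e.toModuleIso _
  have h₂' : ¬ HasProjectiveDimensionLT (ModuleCat.of R (P.syzygy (l + 2))) (l + 1) :=
    fun _ ↦ h₂ (hasProjectiveDimensionLT_of_iso e.symm.toModuleIso _)
  rw [P.hasProjectiveDimensionLT_syzygy_iff] at h₁' h₂'
  -- Any finite strict bound on the dimension starts the induction; the number of generators of `𝔪`
  -- plus one is such a bound.
  have hdim : ringKrullDim R < ((maximalIdeal R).spanFinrank + 1 : ℕ) :=
    (ringKrullDim_le_spanFinrank_maximalIdeal R).trans_lt (Nat.cast_lt.mpr (Nat.lt_succ_self _))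
  obtain ⟨rs, hrs, hmax⟩ := exists_isRegular_ofList_eq_maximalIdeal _ R hdim _ h₁'
  -- With `i = l + 2` the two bounds become `2l + 3 ≤ rs.length < 2l + 4`, so the length is `2i -
  -- 1`.
  rw [hasProjectiveDimensionLT_residueField_iff hrs hmax] at h₁' h₂'
  refine ⟨isRegularLocalRing_of_ofList_eq_maximalIdeal hrs hmax, ?_⟩
  rw [localDepth_eq_length_of_ofList_eq_maximalIdeal hrs hmax]
  congr 1
  lia
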